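/- Let $n\ge 2$ and let $H^n$ be the $n$-dimensional hyperbolic space with geodesic distance $d$; write $B(z,\varrho)=\{x\in H^n : d(x,z)\le \varrho\}$ for $z\in H^n$, $\varrho\ge 0$. A set $K\subseteq H^n$ is called complete if $\operatorname{diam}(K\cup\{y\})>\operatorname{diam}(K)$ for every $y\in H^n\setminus K$. Let $K\subset H^n$ be a complete set of (finite) diameter $D>0$. Then the circumradius and the inradius $$R(K)=\min\{R\ge 0 : K\subseteq B(z,R)\text{ for some }z\in H^n\},\qquad r(K)=\max\{r\ge 0 : B(z,r)\subseteq K\text{ for some }z\in H^n\}$$ exist (the minimum and the maximum are attained), and $$R(K)+r(K)=D.$$ Moreover, there is a unique point $p\in H^n$ (the circumcenter) with $K\subseteq B(p,R(K))$, and $p$ is also the unique point with $B(p,r(K))\subseteq K$; that is, $K$ has a unique inscribed ball, and its center is the circumcenter of $K$. -/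

import Mathlib

/-- Hyperbolic `n`-space, hyperboloid model: the points `x₀ + t e` of `ℝⁿ⁺¹ = e^⊥ ⊕ ℝ e` with
`t ≥ 1` and `t² - ⟨x₀, x₀⟩ = 1`, where `e^⊥` is identified with `EuclideanSpace ℝ (Fin n)`. -/
@[ext]
structure HypSpace (n : ℕ) where
  x₀ : EuclideanSpace ℝ (Fin n)
  t : ℝ
  one_le_t : 1 ≤ t
  sq_sub_inner : t ^ 2 - inner ℝ x₀ x₀ = 1

namespace HypSpace

variable {n : ℕ}

/-- The bilinear form `𝓑(x, y) = t s - ⟨x₀, y₀⟩` for `x = x₀ + t e`, `y = y₀ + s e`. -/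
noncomputable def lorentz (x y : HypSpace n) : ℝ := x.t * y.t - inner ℝ x.x₀ y.x₀

theorem lorentz_comm (x y : HypSpace n) : lorentz x y = lorentz y x := by
  simp only [lorentz, real_inner_comm, mul_comm]

theorem lorentz_self (x : HypSpace n) : lorentz x x = 1 := by
  have := x.sq_sub_inner
  simp only [lorentz]
  linarith

/-- The form is negative semidefinite on the tangent space at `y`; quantitative version. -/
theorem tangent_ineq (y : HypSpace n) (p : EuclideanSpace ℝ (Fin n)) (τ : ℝ)
    (h : τ * y.t = inner ℝ p y.x₀) : τ ^ 2 * y.t ^ 2 ≤ inner ℝ p p * (y.t ^ 2 - 1) := by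
  have h1 := real_inner_mul_inner_self_le p y.x₀
  have h2 := y.sq_sub_inner
  have h3 : inner ℝ y.x₀ y.x₀ = y.t ^ 2 - 1 := by linarith
  rw [← h, h3] at h1
  nlinarith

theorem tangent_nonpos (y : HypSpace n) (p : EuclideanSpace ℝ (Fin n)) (τ : ℝ)
    (h : τ * y.t = inner ℝ p y.x₀) : τ ^ 2 - inner ℝ p p ≤ 0 := by
  have h1 := tangent_ineq y p τ h
  have h2 : 0 ≤ inner ℝ p p := real_inner_self_nonneg
  have h3 := y.one_le_t
  have h4 : (τ ^ 2 - inner ℝ p p) * y.t ^ 2 ≤ 0 := by nlinarith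
  have h5 : 0 < y.t ^ 2 := by positivity
  by_contra hc
  push Not at hc
  nlinarith [mul_pos hc h5]

theorem one_le_lorentz (x y : HypSpace n) : 1 ≤ lorentz x y := by
  have h1 := real_inner_mul_inner_self_le x.x₀ y.x₀
  have hx := x.sq_sub_inner
  have hy := y.sq_sub_inner
  have hx1 := x.one_le_t
  have hy1 := y.one_le_t
  have hx2 : inner ℝ x.x₀ x.x₀ = x.t ^ 2 - 1 := by linarith
  have hy2 : inner ℝ y.x₀ y.x₀ = y.t ^ 2 - 1 := by linarith
  rw [hx2, hy2] at h1
  simp only [lorentz]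
  set i : ℝ := inner ℝ x.x₀ y.x₀
  have h2 : i ^ 2 ≤ (x.t * y.t - 1) ^ 2 := by nlinarith [sq_nonneg (x.t - y.t)]
  have h3 : 0 ≤ x.t * y.t - 1 := by nlinarith
  have := abs_le_of_sq_le_sq' h2 h3
  linarith [this.2]

theorem eq_of_lorentz_eq_one {x y : HypSpace n} (h : lorentz x y = 1) : x = y := by
  have hx := x.sq_sub_inner
  have hy := y.sq_sub_inner
  have hy1 := y.one_le_t
  have e1 : (x.t - y.t) * y.t = inner ℝ (x.x₀ - y.x₀) y.x₀ := by
    simp only [lorentz] at h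
    rw [inner_sub_left]
    nlinarith
  have e2 : inner ℝ (x.x₀ - y.x₀) (x.x₀ - y.x₀) = (x.t - y.t) ^ 2 := by
    simp only [lorentz] at h
    rw [real_inner_sub_sub_self]
    nlinarith
  have h3 := tangent_ineq y _ _ e1
  rw [e2] at h3
  have h4 : (x.t - y.t) ^ 2 = 0 := le_antisymm (by nlinarith) (sq_nonneg _)
  rw [h4] at e2
  ext1
  · exact sub_eq_zero.1 (inner_self_eq_zero.1 e2)
  · exact sub_eq_zero.1 (pow_eq_zero_iff two_ne_zero |>.1 h4)

theorem lorentz_sub_sq_le (x y z : HypSpace n) :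
    (lorentz x z - lorentz x y * lorentz y z) ^ 2
      ≤ (lorentz x y ^ 2 - 1) * (lorentz y z ^ 2 - 1) := by
  have hx := x.sq_sub_inner
  have hy := y.sq_sub_inner
  have hz := z.sq_sub_inner
  have key : ∀ l : ℝ, 0 ≤ (lorentz x y ^ 2 - 1) * (l * l)
      + (-2 * (lorentz x z - lorentz x y * lorentz y z)) * l + (lorentz y z ^ 2 - 1) := by
    intro l
    have h := tangent_nonpos y
      (l • (x.x₀ - lorentz x y • y.x₀) + (z.x₀ - lorentz y z • y.x₀))
      (l * (x.t - lorentz x y * y.t) + (z.t - lorentz y z * y.t))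
    simp only [inner_add_left, inner_add_right, inner_sub_left, inner_sub_right,
      real_inner_smul_left, real_inner_smul_right] at h
    have c1 : inner ℝ y.x₀ x.x₀ = inner ℝ x.x₀ y.x₀ := real_inner_comm _ _
    have c2 : inner ℝ z.x₀ y.x₀ = inner ℝ y.x₀ z.x₀ := real_inner_comm _ _
    have c3 : inner ℝ z.x₀ x.x₀ = inner ℝ x.x₀ z.x₀ := real_inner_comm _ _
    have e1 : inner ℝ x.x₀ x.x₀ = x.t ^ 2 - 1 := by linarith
    have e2 : inner ℝ y.x₀ y.x₀ = y.t ^ 2 - 1 := by linarith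
    have e3 : inner ℝ z.x₀ z.x₀ = z.t ^ 2 - 1 := by linarith
    simp only [lorentz] at h ⊢
    rw [e1, e2, e3, c1, c2, c3] at h
    have := h (by ring)
    linarith
  have := discrim_le_zero key
  rw [discrim] at this
  nlinarith

/-- The geodesic distance, `cosh d(x, y) = 𝓑(x, y)`. -/
noncomputable instance : Dist (HypSpace n) := ⟨fun x y => Real.arcosh (lorentz x y)⟩

theorem dist_def (x y : HypSpace n) : dist x y = Real.arcosh (lorentz x y) := rfl

theorem dist_triangle_aux (x y z : HypSpace n) : dist x z ≤ dist x y + dist y z := by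
  have h1 := one_le_lorentz x y
  have h2 := one_le_lorentz y z
  have h3 := one_le_lorentz x z
  have n1 : 0 ≤ dist x y := Real.arcosh_nonneg h1
  have n2 : 0 ≤ dist y z := Real.arcosh_nonneg h2
  have key : lorentz x z ≤ Real.cosh (dist x y + dist y z) := by
    rw [dist_def, dist_def, Real.cosh_add, Real.cosh_arcosh h1, Real.cosh_arcosh h2,
      Real.sinh_arcosh h1, Real.sinh_arcosh h2, ← Real.sqrt_mul (by nlinarith)]
    have := Real.le_sqrt_of_sq_le (lorentz_sub_sq_le x y z)
    linarith
  have h4 := (Real.arcosh_le_arcosh (by linarith) (Real.cosh_pos _)).2 key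
  rwa [Real.arcosh_cosh (add_nonneg n1 n2)] at h4

/-- `Hⁿ` with its geodesic distance. -/
noncomputable instance : MetricSpace (HypSpace n) where
  dist_self x := by rw [dist_def, lorentz_self, Real.arcosh_zero]
  dist_comm x y := by rw [dist_def, dist_def, lorentz_comm]
  dist_triangle := dist_triangle_aux
  eq_of_dist_eq_zero {x y} h :=
    eq_of_lorentz_eq_one ((Real.arcosh_eq_zero_iff (one_le_lorentz x y)).1 h)

/-- Along the geodesic line `s ↦ z cosh s + u sinh s` through `z` with unit tangent vector
`u = u₀ + τ e` at `z`, the distance from `z` is `|s|`. -/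
theorem dist_geodesic (z p : HypSpace n) (u₀ : EuclideanSpace ℝ (Fin n)) (τ s : ℝ)
    (hu : z.t * τ - inner ℝ z.x₀ u₀ = 0)
    (hx : p.x₀ = Real.cosh s • z.x₀ + Real.sinh s • u₀)
    (ht : p.t = Real.cosh s * z.t + Real.sinh s * τ) : dist z p = |s| := by
  have h : lorentz z p = Real.cosh |s| := by
    have hz := z.sq_sub_inner
    rw [lorentz, hx, ht, inner_add_right, real_inner_smul_right, real_inner_smul_right,
      Real.cosh_abs]
    linear_combination Real.cosh s * hz + Real.sinh s * hu
  rw [dist_def, h, Real.arcosh_cosh (abs_nonneg s)]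

/-- `K` is complete if adding any further point increases the (possibly infinite) diameter.
`Metric.ediam K` is the diameter of `K` as an element of `[0, ∞]`. -/
def IsDiamComplete (K : Set (HypSpace n)) : Prop :=
  ∀ y, y ∉ K → Metric.ediam K < Metric.ediam (K ∪ {y})

/-- The radii `R ≥ 0` of the closed balls that contain `K`. -/
def outerRadii (K : Set (HypSpace n)) : Set ℝ :=
  {R | 0 ≤ R ∧ ∃ z, K ⊆ Metric.closedBall z R}

/-- The radii `r ≥ 0` of the closed balls contained in `K`. -/
def innerRadii (K : Set (HypSpace n)) : Set ℝ :=
  {r | 0 ≤ r ∧ ∃ z, Metric.closedBall z r ⊆ K}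

/-- The circumradius `R(K)`. -/
noncomputable def circumradius (K : Set (HypSpace n)) : ℝ := sInf (outerRadii K)

/-- The inradius `r(K)`. -/
noncomputable def inradius (K : Set (HypSpace n)) : ℝ := sSup (innerRadii K)

end HypSpace

namespace HypSpace

variable {n : ℕ}

/-! Balls around and balls inside a complete set are dual. If `K` lies in the ball of radius `R`
about `p`, the triangle inequality puts every point of the ball of radius `D - R` about `p` within
`D` of all of `K`, hence in `K` by completeness (`closedBall_sub_subset`). Conversely, if `K`
contains the ball of radius `r` about `z`, prolonging the geodesic from `x ∈ K` to `z` by `r` ends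
in `K`, so `dist x z + r ≤ D` (`subset_closedBall_sub`). So the inradius is `D` minus the
circumradius, with the same centers. It remains that a smallest enclosing ball exists, by
compactness, and is unique, by a midpoint argument. -/

theorem cosh_dist (x y : HypSpace n) : Real.cosh (dist x y) = lorentz x y := by
  rw [dist_def, Real.cosh_arcosh (one_le_lorentz x y)]

theorem dist_le_iff_lorentz_le {x y : HypSpace n} {ρ : ℝ} (hρ : 0 ≤ ρ) :
    dist x y ≤ ρ ↔ lorentz x y ≤ Real.cosh ρ := by
  rw [← cosh_dist, Real.cosh_le_cosh, abs_of_nonneg dist_nonneg, abs_of_nonneg hρ]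

theorem dist_eq_of_lorentz_eq {x y : HypSpace n} {ρ : ℝ} (hρ : 0 ≤ ρ)
    (h : lorentz x y = Real.cosh ρ) : dist x y = ρ := by
  rw [dist_def, h, Real.arcosh_cosh hρ]

/-! ### Closed balls are compact -/

/-- The point of the hyperboloid over a vector of `e^⊥`. -/
noncomputable def lift (v : EuclideanSpace ℝ (Fin n)) : HypSpace n where
  x₀ := v
  t := √(1 + ‖v‖ ^ 2)
  one_le_t := Real.one_le_sqrt.2 (by nlinarith [sq_nonneg ‖v‖])
  sq_sub_inner := by
    rw [Real.sq_sqrt (by positivity), real_inner_self_eq_norm_sq]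
    ring

theorem lift_x₀ (x : HypSpace n) : lift x.x₀ = x := by
  have h := x.sq_sub_inner
  have h1 := x.one_le_t
  rw [real_inner_self_eq_norm_sq] at h
  ext1
  · rfl
  · change √(1 + ‖x.x₀‖ ^ 2) = x.t
    rw [show 1 + ‖x.x₀‖ ^ 2 = x.t ^ 2 by linarith, Real.sqrt_sq (by linarith)]

theorem continuous_lift : Continuous (lift : EuclideanSpace ℝ (Fin n) → HypSpace n) := by
  rw [continuous_iff_continuousAt]
  intro v
  rw [ContinuousAt, tendsto_iff_dist_tendsto_zero]
  have hl : Continuous fun w => lorentz (lift w) (lift v) := by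
    simp only [lorentz, lift]
    fun_prop
  have h : Continuous fun w => dist (lift w) (lift v) :=
    Real.continuousOn_arcosh.comp_continuous hl fun w => one_le_lorentz _ _
  simpa using h.tendsto v

/-- The height `x.t` is `cosh` of the distance to the apex `lift 0`, and it dominates `‖x.x₀‖`.
Hence hyperbolic balls have bounded projections. -/
theorem norm_x₀_le (x : HypSpace n) : ‖x.x₀‖ ≤ Real.cosh (dist x (lift 0)) := by
  have h := x.sq_sub_inner
  have h1 := x.one_le_t
  rw [real_inner_self_eq_norm_sq] at h
  rw [cosh_dist]
  have : lorentz x (lift 0) = x.t := by simp [lorentz, lift]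
  rw [this]
  exact abs_le_of_sq_le_sq' (by linarith) (by linarith) |>.2

instance : ProperSpace (HypSpace n) := by
  refine ⟨fun x r => ?_⟩
  refine ((isCompact_closedBall (0 : EuclideanSpace ℝ (Fin n))
    (Real.cosh (r + dist x (lift 0)))).image continuous_lift).of_isClosed_subset
      Metric.isClosed_closedBall fun y hy => ⟨y.x₀, ?_, lift_x₀ y⟩
  rw [mem_closedBall_zero_iff]
  refine (norm_x₀_le y).trans (Real.cosh_le_cosh.2 ?_)
  rw [abs_of_nonneg dist_nonneg]
  exact (dist_triangle y x _).trans ((add_le_add_left hy _).trans (le_abs_self _))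

/-! ### Geodesics -/

/-- The midpoint `m` of `z` and `w` is the normalized sum of `z` and `w`. -/
theorem exists_lorentz_midpoint (z w : HypSpace n) : ∃ m : HypSpace n, ∀ x,
    √(2 + 2 * lorentz z w) * lorentz x m = lorentz x z + lorentz x w := by
  have hL := one_le_lorentz z w
  set c := √(2 + 2 * lorentz z w) with hc
  have hcpos : 0 < c := Real.sqrt_pos.2 (by linarith)
  have hc2 : c ^ 2 = 2 + 2 * lorentz z w := Real.sq_sqrt (by linarith)
  have hz := z.sq_sub_inner
  have hw := w.sq_sub_inner
  have hz1 := z.one_le_t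
  have hw1 := w.one_le_t
  have hsq : (c⁻¹ * (z.t + w.t)) ^ 2 -
      inner ℝ (c⁻¹ • (z.x₀ + w.x₀)) (c⁻¹ • (z.x₀ + w.x₀)) = 1 := by
    rw [real_inner_smul_left, real_inner_smul_right, real_inner_add_add_self]
    have : (z.t + w.t) ^ 2 - (inner ℝ z.x₀ z.x₀ + 2 * inner ℝ z.x₀ w.x₀ + inner ℝ w.x₀ w.x₀)
        = c ^ 2 := by
      rw [hc2, lorentz]
      linear_combination hz + hw
    field_simp
    linarith
  have hpos : 0 < c⁻¹ * (z.t + w.t) := by positivity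
  -- The square of the height is at least 1 by `hsq`; positivity selects the upper sheet.
  have hone : 1 ≤ c⁻¹ * (z.t + w.t) := by
    have := real_inner_self_nonneg (x := c⁻¹ • (z.x₀ + w.x₀))
    nlinarith
  refine ⟨⟨_, _, hone, hsq⟩, fun x => ?_⟩
  simp only [lorentz, real_inner_smul_right, inner_add_right]
  field_simp
  ring

/-- A geodesic segment from `x` to `z` can be prolonged beyond `z` by any length. -/
theorem exists_dist_eq_add {x z : HypSpace n} (hxz : x ≠ z) {r : ℝ} (hr : 0 ≤ r) :
    ∃ y, dist z y = r ∧ dist x y = dist x z + r := by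
  set a := dist x z with ha
  have hapos : 0 < a := dist_pos.2 hxz
  have hs : 0 < Real.sinh a := Real.sinh_pos_iff.2 hapos
  have hL : lorentz x z = Real.cosh a := (cosh_dist x z).symm
  have hx := x.sq_sub_inner
  have hz := z.sq_sub_inner
  have hz1 := z.one_le_t
  have hcs := Real.cosh_sq a
  have hcr := Real.cosh_sq r
  have hL' : x.t * z.t - inner ℝ x.x₀ z.x₀ = Real.cosh a := hL
  set s := Real.sinh a
  set c := Real.cosh a
  -- `u₀ + τ e` is the unit tangent vector at `z` pointing away from `x`.
  set u₀ := s⁻¹ • (c • z.x₀ - x.x₀) with hu₀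
  set τ := s⁻¹ * (c * z.t - x.t) with hτ
  have horth : z.t * τ - inner ℝ z.x₀ u₀ = 0 := by
    rw [hu₀, hτ, real_inner_smul_right, inner_sub_right, real_inner_smul_right,
      real_inner_comm x.x₀]
    linear_combination s⁻¹ * (c * hz - hL')
  have hunit : inner ℝ u₀ u₀ = τ ^ 2 + 1 := by
    rw [hu₀, hτ, real_inner_smul_left, real_inner_smul_right, real_inner_sub_sub_self,
      real_inner_smul_left, real_inner_smul_left, real_inner_smul_right, real_inner_comm x.x₀]
    field_simp
    linear_combination -(c ^ 2 * hz) - hx + 2 * c * hL' + hcs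
  have hxu : x.t * τ - inner ℝ x.x₀ u₀ = s := by
    rw [hu₀, hτ, real_inner_smul_right, inner_sub_right, real_inner_smul_right]
    field_simp
    linear_combination c * hL' - hx + hcs
  -- This bound and `sinh r < cosh r` keep the prolonged geodesic on the upper sheet.
  have hτle : |τ| ≤ z.t := by
    have h := tangent_ineq z u₀ τ (by rw [real_inner_comm]; linarith)
    rw [hunit] at h
    exact abs_le_of_sq_le_sq (by nlinarith) (by linarith)
  have hsr : 0 ≤ Real.sinh r := Real.sinh_nonneg_iff.2 hr
  have hsc : Real.sinh r < Real.cosh r := Real.sinh_lt_cosh r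
  have hpos : 0 < Real.cosh r * z.t + Real.sinh r * τ := by
    have := (abs_le.1 hτle).1
    nlinarith
  have hsq : (Real.cosh r * z.t + Real.sinh r * τ) ^ 2 -
      inner ℝ (Real.cosh r • z.x₀ + Real.sinh r • u₀) (Real.cosh r • z.x₀ + Real.sinh r • u₀)
        = 1 := by
    rw [real_inner_add_add_self]
    simp only [real_inner_smul_left, real_inner_smul_right]
    linear_combination Real.cosh r ^ 2 * hz + 2 * Real.cosh r * Real.sinh r * horth
      - Real.sinh r ^ 2 * hunit + hcr
  have hone : 1 ≤ Real.cosh r * z.t + Real.sinh r * τ := by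
    have := real_inner_self_nonneg (x := Real.cosh r • z.x₀ + Real.sinh r • u₀)
    nlinarith
  refine ⟨⟨_, _, hone, hsq⟩, ?_, ?_⟩
  · rw [dist_geodesic z _ u₀ τ r horth rfl rfl, abs_of_nonneg hr]
  · refine dist_eq_of_lorentz_eq (by linarith) ?_
    rw [Real.cosh_add]
    change x.t * _ - inner ℝ x.x₀ _ = c * Real.cosh r + s * Real.sinh r
    rw [inner_add_right, real_inner_smul_right, real_inner_smul_right]
    linear_combination Real.cosh r * hL' + Real.sinh r * hxu

/-! ### Circumscribed balls -/

theorem bddBelow_outerRadii (K : Set (HypSpace n)) : BddBelow (outerRadii K) :=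
  ⟨0, fun _ h => h.1⟩

/-- The centers for a minimizing sequence of radii stay within bounded distance of a point of `K`,
so a subsequence converges; the limit is a center for the infimum. -/
theorem exists_subset_closedBall_circumradius {K : Set (HypSpace n)} (hne : K.Nonempty)
    (hK : (outerRadii K).Nonempty) : ∃ p, K ⊆ Metric.closedBall p (circumradius K) := by
  obtain ⟨u, -, hu, hmem⟩ := exists_seq_tendsto_sInf hK (bddBelow_outerRadii K)
  choose z hz using fun k => (hmem k).2
  obtain ⟨a, ha⟩ := hne
  obtain ⟨M, hM⟩ := hu.bddAbove_range
  have hb : ∀ k, z k ∈ Metric.closedBall a M := fun k => by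
    rw [Metric.mem_closedBall']
    exact (Metric.mem_closedBall.1 (hz k ha)).trans (hM ⟨k, rfl⟩)
  obtain ⟨p, -, φ, hφ, hp⟩ := tendsto_subseq_of_bounded Metric.isBounded_closedBall hb
  exact ⟨p, fun x hx => le_of_tendsto_of_tendsto' (tendsto_const_nhds.dist hp)
    (hu.comp hφ.tendsto_atTop) fun k => hz _ hx⟩

theorem circumradius_nonneg (K : Set (HypSpace n)) : 0 ≤ circumradius K :=
  Real.sInf_nonneg fun _ h => h.1

theorem isLeast_circumradius {K : Set (HypSpace n)} (hne : K.Nonempty)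
    (hK : (outerRadii K).Nonempty) : IsLeast (outerRadii K) (circumradius K) :=
  ⟨⟨circumradius_nonneg K, exists_subset_closedBall_circumradius hne hK⟩,
    fun _ h => csInf_le (bddBelow_outerRadii K) h⟩

/-- The circumscribed ball is unique. -/
theorem eq_of_subset_closedBall_circumradius {K : Set (HypSpace n)} (hne : K.Nonempty)
    {z w : HypSpace n} (hz : K ⊆ Metric.closedBall z (circumradius K))
    (hw : K ⊆ Metric.closedBall w (circumradius K)) : z = w := by
  by_contra hzw
  obtain ⟨m, hm⟩ := exists_lorentz_midpoint z w
  have hL : 1 < lorentz z w :=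
    (one_le_lorentz z w).lt_of_ne' fun h => hzw (eq_of_lorentz_eq_one h)
  have hR := circumradius_nonneg K
  set R := circumradius K with hRdef
  -- Since `c > 2` for distinct centers, the ball about the midpoint `m` that contains `K` has
  -- radius strictly below `R`.
  have hc : 2 < √(2 + 2 * lorentz z w) := Real.lt_sqrt_of_sq_lt (by linarith)
  set c := √(2 + 2 * lorentz z w)
  have hle : ∀ x ∈ K, lorentz x m ≤ 2 * Real.cosh R / c := fun x hx => by
    have h1 := (dist_le_iff_lorentz_le hR).1 (hz hx)
    have h2 := (dist_le_iff_lorentz_le hR).1 (hw hx)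
    rw [le_div_iff₀ (by linarith)]
    linarith [hm x]
  have hlt : 2 * Real.cosh R / c < Real.cosh R := by
    rw [div_lt_iff₀ (by linarith)]
    nlinarith [Real.cosh_pos R]
  obtain ⟨a, ha⟩ := hne
  -- A point of `K` shows that the bound is at least 1, so its `arcosh` is a genuine radius.
  have h1 : 1 ≤ 2 * Real.cosh R / c := (one_le_lorentz a m).trans (hle a ha)
  have hmem : Real.arcosh (2 * Real.cosh R / c) ∈ outerRadii K :=
    ⟨Real.arcosh_nonneg h1, m, fun x hx => (dist_le_iff_lorentz_le (Real.arcosh_nonneg h1)).2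
      ((Real.cosh_arcosh h1).symm ▸ hle x hx)⟩
  have h2 := (Real.arcosh_lt_arcosh (by linarith) (Real.cosh_pos R)).2 hlt
  rw [Real.arcosh_cosh hR] at h2
  exact absurd (csInf_le (bddBelow_outerRadii K) hmem) (not_le.2 h2)

/-! ### Complete sets -/

theorem dist_le_of_ediam_eq {K : Set (HypSpace n)} {D : ℝ} (hD : 0 ≤ D)
    (hdiam : Metric.ediam K = ENNReal.ofReal D) {x y : HypSpace n} (hx : x ∈ K) (hy : y ∈ K) :
    dist x y ≤ D := by
  rw [← ENNReal.ofReal_le_ofReal_iff hD, ← edist_dist, ← hdiam]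
  exact Metric.edist_le_ediam_of_mem hx hy

/-- A complete set of diameter `D` contains every point at distance at most `D` from it. -/
theorem IsDiamComplete.mem_of_forall_dist_le {K : Set (HypSpace n)} (hK : IsDiamComplete K)
    {D : ℝ} (hdiam : Metric.ediam K = ENNReal.ofReal D) {y : HypSpace n}
    (hy : ∀ x ∈ K, dist x y ≤ D) : y ∈ K := by
  by_contra hyK
  have h := hK y hyK
  rw [Set.union_singleton, Metric.ediam_insert] at h
  refine absurd h (not_lt.2 (max_le (iSup₂_le fun x hx => ?_) le_rfl))
  rw [hdiam, edist_comm, edist_dist]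
  exact ENNReal.ofReal_le_ofReal (hy x hx)

theorem IsDiamComplete.closedBall_sub_subset {K : Set (HypSpace n)} (hK : IsDiamComplete K)
    {D R : ℝ} (hdiam : Metric.ediam K = ENNReal.ofReal D) {p : HypSpace n}
    (hp : K ⊆ Metric.closedBall p R) : Metric.closedBall p (D - R) ⊆ K := fun y hy =>
  hK.mem_of_forall_dist_le hdiam fun x hx => by
    have h1 : dist x p ≤ R := hp hx
    have h2 : dist p y ≤ D - R := Metric.mem_closedBall'.1 hy
    linarith [dist_triangle x p y]

/-- If `K` contains the ball of radius `r` about `z`, it lies in the ball of radius `D - r`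
about `z`. -/
theorem subset_closedBall_sub {K : Set (HypSpace n)} {D r : ℝ} (hD : 0 < D)
    (hdiam : Metric.ediam K = ENNReal.ofReal D) (hr : 0 ≤ r) {z : HypSpace n}
    (hz : Metric.closedBall z r ⊆ K) : r ≤ D ∧ K ⊆ Metric.closedBall z (D - r) := by
  have key : ∀ x ∈ K, x ≠ z → dist x z + r ≤ D := fun x hx hxz => by
    obtain ⟨y, hy, hxy⟩ := exists_dist_eq_add hxz hr
    rw [← hxy]
    exact dist_le_of_ediam_eq hD.le hdiam hx (hz (Metric.mem_closedBall'.2 hy.le))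
  -- No geodesic direction is given when `x = z`; that case needs only `r ≤ D`, which a point of `K`
  -- other than `z` supplies.
  have hnt : K.Nontrivial := Metric.ediam_pos_iff.1 (hdiam ▸ ENNReal.ofReal_pos.2 hD)
  obtain ⟨a, ha, haz⟩ := hnt.exists_ne z
  have hrD : r ≤ D := by linarith [key a ha haz, dist_nonneg (x := a) (y := z)]
  refine ⟨hrD, fun x hx => ?_⟩
  rw [Metric.mem_closedBall]
  rcases eq_or_ne x z with rfl | hxz
  · rw [dist_self]
    linarith
  · linarith [key x hx hxz]

end HypSpace

theorem mainTheorem4 (n : ℕ) (hn : 2 ≤ n) (K : Set (HypSpace n)) (D : ℝ) (hD : 0 < D)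
    (hdiam : Metric.ediam K = ENNReal.ofReal D) (hK : HypSpace.IsDiamComplete K) :
    -- the minimum and the maximum that define `R(K)` and `r(K)` are attained
    IsLeast (HypSpace.outerRadii K) (HypSpace.circumradius K) ∧
    IsGreatest (HypSpace.innerRadii K) (HypSpace.inradius K) ∧
    HypSpace.circumradius K + HypSpace.inradius K = D ∧
    -- `p` is the circumcenter, and the only center of an inscribed ball
    ∃ p : HypSpace n,
      (∀ z, K ⊆ Metric.closedBall z (HypSpace.circumradius K) ↔ z = p) ∧
      (∀ z, Metric.closedBall z (HypSpace.inradius K) ⊆ K ↔ z = p) := by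
  have hne : K.Nonempty :=
    (Metric.ediam_pos_iff.1 (hdiam ▸ ENNReal.ofReal_pos.2 hD)).nonempty
  obtain ⟨a, ha⟩ := hne
  have hDmem : D ∈ HypSpace.outerRadii K :=
    ⟨hD.le, a, fun x hx => HypSpace.dist_le_of_ediam_eq hD.le hdiam hx ha⟩
  have hleast := HypSpace.isLeast_circumradius ⟨a, ha⟩ ⟨D, hDmem⟩
  obtain ⟨p, hp⟩ := hleast.1.2
  have hgreatest : IsGreatest (HypSpace.innerRadii K) (D - HypSpace.circumradius K) := by
    refine ⟨⟨sub_nonneg.2 (hleast.2 hDmem), p, hK.closedBall_sub_subset hdiam hp⟩, ?_⟩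
    rintro r ⟨hr, z, hz⟩
    obtain ⟨hrD, hsub⟩ := HypSpace.subset_closedBall_sub hD hdiam hr hz
    linarith [hleast.2 ⟨sub_nonneg.2 hrD, z, hsub⟩]
  have hin : HypSpace.inradius K = D - HypSpace.circumradius K := hgreatest.csSup_eq
  have huniq : ∀ z, K ⊆ Metric.closedBall z (HypSpace.circumradius K) → z = p := fun z hz =>
    HypSpace.eq_of_subset_closedBall_circumradius ⟨a, ha⟩ hz hp
  rw [hin]
  refine ⟨hleast, hgreatest, by ring, p, fun z => ⟨huniq z, fun h => h ▸ hp⟩,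
    fun z => ⟨fun hz => huniq z ?_, fun h => h ▸ hK.closedBall_sub_subset hdiam hp⟩⟩
  -- An inscribed ball of radius `D - R` makes its center `z` a circumcenter, since `D - (D - R) =
  -- R`.
  have h := (HypSpace.subset_closedBall_sub hD hdiam hgreatest.1.1 hz).2
  rwa [sub_sub_cancel] at h
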